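/- Let $X$ be a real Banach space with dual $X^*$. A set $B\subseteq B_{X^*}$ in the closed dual unit ball is a *boundary* of $X$ if for every $x\in X$ with $\|x\|=1$ there is $f\in B$ with $f(x)=1$. A set $E\subseteq X^*$ is *$w^*$-LRC* if for every $y\in E$ there is a $w^*$-open set $U\ni y$ such that the norm closure of $E\cap U$ is norm compact; it is *$\sigma$-$w^*$-LRC* (respectively *$\sigma$-$w^*$-compact*) if it is a countable union of $w^*$-LRC (respectively $w^*$-compact) sets. A norm on $X$ is *$C^\infty$ smooth* if it is infinitely often Fréchet differentiable on $X\setminus\{0\}$. For $\varepsilon>0$, a norm $|||\cdot|||$ on $X$ *$\varepsilon$-approximates* $\|\cdot\|$ if $(1-\varepsilon)\|x\|\le |||x|||\le(1+\varepsilon)\|x\|$ for all $x\in X$. **Corollary.** Suppose that $X$ has a boundary that is both $\sigma$-$w^*$-LRC and $\sigma$-$w^*$-compact. Then for every $\varepsilon>0$ there is an equivalent $C^\infty$ smooth norm on $X$ that $\varepsilon$-approximates $\|\cdot\|$. In particular, for every $\varepsilon>0$ the same conclusion holds in the following two cases: 1. (Hájek) $X$ is a real Banach space with a boundary contained in a norm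 $\sigma$-compact subset of $B_{X^*}$. 2. (Hájek–Haydon) $X=C(K)$, the space of real continuous functions on $K$ with the supremum norm, where $K$ is a compact Hausdorff space that is $\sigma$-discrete, i.e. $K=\bigcup_{n=0}^\infty D_n$ where for each $n$ and each $x\in D_n$ there is an open $U\subseteq K$ with $U\cap D_n=\{x\}$. -/

import Mathlib

open scoped ContDiff

section Dual

variable {X : Type*} [NormedAddCommGroup X] [NormedSpace ℝ X]

/-- `B ⊆ B_{X*}` is a boundary of `X`: every `x` in the unit sphere of `X` satisfies `f x = 1` for
some `f ∈ B`. -/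
def IsBoundary (B : Set (StrongDual ℝ X)) : Prop :=
  B ⊆ Metric.closedBall 0 1 ∧ ∀ x : X, ‖x‖ = 1 → ∃ f ∈ B, f x = 1

/-- `E ⊆ X*` is `w*`-locally relatively compact: every `y ∈ E` has a `w*`-open neighbourhood `U`
such that the norm closure of `E ∩ U` is norm compact. -/
def IsWeakStarLRC (E : Set (StrongDual ℝ X)) : Prop :=
  ∀ y ∈ E, ∃ U : Set (WeakDual ℝ X), IsOpen U ∧ StrongDual.toWeakDual y ∈ U ∧
    IsCompact (closure (E ∩ StrongDual.toWeakDual ⁻¹' U))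

/-- `E` is a countable union of `w*`-LRC sets. -/
def IsSigmaWeakStarLRC (E : Set (StrongDual ℝ X)) : Prop :=
  ∃ S : ℕ → Set (StrongDual ℝ X), (∀ n, IsWeakStarLRC (S n)) ∧ E = ⋃ n, S n

/-- `E` is a countable union of `w*`-compact sets. -/
def IsSigmaWeakStarCompact (E : Set (StrongDual ℝ X)) : Prop :=
  IsSigmaCompact (StrongDual.toWeakDual '' E)

/-- The seminorm `p` is a norm on `X` that is equivalent to the given norm. -/
def IsEquivalentNorm (p : Seminorm ℝ X) : Prop :=
  ∃ c C : ℝ, 0 < c ∧ 0 < C ∧ ∀ x : X, c * ‖x‖ ≤ p x ∧ p x ≤ C * ‖x‖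

/-- `p` is `C^∞` smooth (with respect to Fréchet derivatives) on `X \ {0}`. -/
def IsSmoothNorm (p : Seminorm ℝ X) : Prop :=
  ContDiffOn ℝ ∞ (fun x : X => p x) {0}ᶜ

/-- `p` `ε`-approximates the given norm of `X`. -/
def ApproximatesNorm (ε : ℝ) (p : Seminorm ℝ X) : Prop :=
  ∀ x : X, (1 - ε) * ‖x‖ ≤ p x ∧ p x ≤ (1 + ε) * ‖x‖

end Dual

/-- For every `ε > 0` there is an equivalent `C^∞` smooth norm on `X` that `ε`-approximates the
given norm. -/
def HasApproximatingSmoothNorms (X : Type*) [NormedAddCommGroup X] [NormedSpace ℝ X] : Prop :=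
  ∀ ε : ℝ, 0 < ε → ∃ p : Seminorm ℝ X,
    IsEquivalentNorm p ∧ IsSmoothNorm p ∧ ApproximatesNorm ε p

/-- `K` is a countable union of relatively discrete subsets. -/
def IsSigmaDiscreteSpace (K : Type*) [TopologicalSpace K] : Prop :=
  ∃ D : ℕ → Set K, (⋃ n, D n) = Set.univ ∧
    ∀ n, ∀ x ∈ D n, ∃ U : Set K, IsOpen U ∧ U ∩ D n = {x}

/-! Split the boundary `B` into disjoint `w*`-LRC pieces `S n` whose `w*`-closures stay in `B`, and
choose in each a fine norm net `D n` that meets relatively compact parts in finite sets. Let `E n`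
be the `w*`-closure of `D n`, and scale each `d ∈ ⋃ n, D n` by `1 + F d`, where `F d` is `e` times
the sum of `4^{-(n+1)}` over those `n` with `d ∈ E n`.

The point is that when all scaled functionals are, up to tiny tolerances, at most `1` in modulus at
`x`, only finitely many come close to `1` there. Otherwise infinitely many distinct net points
`w*`-cluster at some `y`. If `y ∉ B`, then `y` is in no `E n`, so upper semicontinuity makes the
scalings tend to `1`, while `‖x‖ < 1`. If `y ∈ S n`, there is `d ∈ D n`, norm-close to `y`, whose `F
d` exceeds the weights at points `w*`-near `y` and different from it by a fixed amount; the scaled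
`d` would then be too large at `x`.

This local finiteness gives smoothness (`exists_smooth_seminorm`): the unit sphere of the new norm
is locally a level set of a finite sum of smooth convex functions, and the implicit function theorem
applies. -/

open Set Filter Topology

/-! ### A smooth convex profile on the line -/

/-- A smooth, even, convex function that vanishes exactly on `[-1, 1]` and exceeds `1` outside
`(-(1 + θ), 1 + θ)`. -/
theorem exists_smooth_convex_even {θ : ℝ} (hθ : 0 < θ) :
    ∃ φ : ℝ → ℝ, ContDiff ℝ ∞ φ ∧ ConvexOn ℝ univ φ ∧ (∀ t, 0 ≤ φ t) ∧ (∀ t, φ (-t) = φ t) ∧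
      (∀ t, |t| ≤ 1 → φ t = 0) ∧ ∀ t, 1 + θ ≤ |t| → 1 < φ t := by
  set g : ℝ → ℝ := fun u => ∫ s in (0 : ℝ)..u, expNegInvGlue s with hg
  have hcont : Continuous expNegInvGlue := (expNegInvGlue.contDiff (n := 0)).continuous
  have hderiv : ∀ u, HasDerivAt g (expNegInvGlue u) u := fun u =>
    intervalIntegral.integral_hasDerivAt_right (hcont.intervalIntegrable _ _)
      (hcont.stronglyMeasurableAtFilter _ _) hcont.continuousAt
  have hdg : deriv g = expNegInvGlue := funext fun u => (hderiv u).deriv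
  have hdiff : Differentiable ℝ g := fun u => (hderiv u).differentiableAt
  have hsmooth : ContDiff ℝ ∞ g := by
    rw [contDiff_infty_iff_deriv, hdg]
    exact ⟨hdiff, expNegInvGlue.contDiff⟩
  have hconv : ConvexOn ℝ univ g := by
    apply Monotone.convexOn_univ_of_deriv hdiff
    rw [hdg]
    exact expNegInvGlue.monotone
  have hmono : Monotone g := by
    apply monotone_of_deriv_nonneg hdiff
    rw [hdg]
    exact expNegInvGlue.nonneg
  have hzero : ∀ u ≤ 0, g u = 0 := by
    intro u hu
    rw [hg]
    dsimp only
    rw [intervalIntegral.integral_congr (g := fun _ => (0 : ℝ)), intervalIntegral.integral_zero]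
    intro s hs
    rw [uIcc_of_ge hu] at hs
    exact expNegInvGlue.zero_of_nonpos hs.2
  have hpos : ∀ u, 0 < u → 0 < g u := by
    intro u hu
    exact intervalIntegral.intervalIntegral_pos_of_pos_on (hcont.intervalIntegrable _ _)
      (fun s hs => expNegInvGlue.pos_of_pos hs.1) hu
  have hnonneg : ∀ u, 0 ≤ g u := fun u => by
    rcases le_or_gt u 0 with h | h
    · exact (hzero u h).ge
    · exact (hpos u h).le
  have hc : 0 < g ((1 + θ) ^ 2 - 1) := hpos _ (by nlinarith)
  have hsq : ConvexOn ℝ univ (fun t : ℝ => t ^ 2 - 1) := by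
    simp_rw [sub_eq_add_neg]
    exact (even_two.convexOn_pow (𝕜 := ℝ)).add (convexOn_const (-1 : ℝ) convex_univ)
  -- The factor makes the value at `1 + θ` equal to `2`; convexity survives because `g` is monotone
  -- and convex and `t ^ 2 - 1` is convex.
  refine ⟨fun t => 2 / g ((1 + θ) ^ 2 - 1) * g (t ^ 2 - 1), ?_, ?_, ?_, ?_, ?_, ?_⟩
  · exact contDiff_const.mul (hsmooth.comp ((contDiff_id.pow 2).sub contDiff_const))
  · have h1 : ConvexOn ℝ univ (fun t : ℝ => g (t ^ 2 - 1)) := by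
      refine ⟨convex_univ, fun x _ y _ a b ha hb hab => ?_⟩
      exact (hmono (hsq.2 (mem_univ x) (mem_univ y) ha hb hab)).trans
        (hconv.2 (mem_univ _) (mem_univ _) ha hb hab)
    exact h1.smul (by positivity)
  · exact fun t => mul_nonneg (by positivity) (hnonneg _)
  · intro t
    simp
  · intro t ht
    have : t ^ 2 - 1 ≤ 0 := by nlinarith [abs_nonneg t, sq_abs t]
    simp [hzero _ this]
  · intro t ht
    have h1 : (1 + θ) ^ 2 - 1 ≤ t ^ 2 - 1 := by nlinarith [abs_nonneg t, sq_abs t]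
    have h2 := hmono h1
    have h3 : 2 = 2 / g ((1 + θ) ^ 2 - 1) * g ((1 + θ) ^ 2 - 1) := by field_simp
    have h4 : 2 / g ((1 + θ) ^ 2 - 1) * g ((1 + θ) ^ 2 - 1) ≤
        2 / g ((1 + θ) ^ 2 - 1) * g (t ^ 2 - 1) := by gcongr
    linarith

/-! ### Smooth norms from locally finite families of functionals -/

section SmoothGauge

variable {X : Type*} [NormedAddCommGroup X] [NormedSpace ℝ X]

/-- A function whose level set is locally given by a transversal smooth equation is smooth. -/
theorem contDiffAt_of_level_set [CompleteSpace X] {Φ : X → ℝ} (hΦ : ContDiff ℝ ∞ Φ) {x₀ : X}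
    (hx₀ : Φ x₀ = 1) (hd : fderiv ℝ Φ x₀ x₀ ≠ 0) {p : X → ℝ} (hp : ContinuousAt p x₀)
    (hp₀ : p x₀ = 1) (hlevel : ∀ᶠ y in 𝓝 x₀, Φ ((p y)⁻¹ • y) = 1) : ContDiffAt ℝ ∞ p x₀ := by
  -- Near `(x₀, 1)` the equation `f (y, t) = 1` determines `t` as a smooth function of `y`, and `t =
  -- (p y)⁻¹` solves it. Its partial derivative in `t` is the radial derivative of `Φ`.
  set f : X × ℝ → ℝ := fun v => Φ (v.2 • v.1) with hf
  have hfs : ContDiff ℝ ∞ f := hΦ.comp (contDiff_snd.smul contDiff_fst)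
  have hinv : (fderiv ℝ f (x₀, 1) ∘L .inr ℝ X ℝ).IsInvertible := by
    have h1 : HasFDerivAt f (fderiv ℝ f (x₀, 1)) (x₀, 1) :=
      (hfs.differentiable (by simp)).differentiableAt.hasFDerivAt
    have h2 : HasFDerivAt (fun t : ℝ => (x₀, t)) (ContinuousLinearMap.inr ℝ X ℝ) 1 :=
      hasFDerivAt_prodMk_right x₀ 1
    have h3 : HasFDerivAt (fun t : ℝ => Φ (t • x₀)) (fderiv ℝ f (x₀, 1) ∘L .inr ℝ X ℝ) 1 :=
      HasFDerivAt.comp (1 : ℝ) h1 h2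
    have h4 : HasDerivAt (fun t : ℝ => Φ (t • x₀)) (fderiv ℝ Φ x₀ x₀) 1 := by
      have h5 : HasFDerivAt Φ (fderiv ℝ Φ x₀) ((1 : ℝ) • x₀) := by
        rw [one_smul]
        exact (hΦ.differentiable (by simp)).differentiableAt.hasFDerivAt
      have h6 : HasDerivAt (fun t : ℝ => t • x₀) x₀ 1 := by
        simpa using (hasDerivAt_id (1 : ℝ)).smul_const x₀
      exact h5.comp_hasDerivAt 1 h6
    rw [h3.unique h4.hasFDerivAt]
    refine ⟨ContinuousLinearEquiv.unitsEquivAut ℝ (Units.mk0 _ hd), ?_⟩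
    ext
    simp
  have hcd : ContDiffAt ℝ ∞ f (x₀, 1) := hfs.contDiffAt
  have hq := hcd.contDiffAt_implicitFunction (by simp) hinv
  have hev := hcd.eventually_apply_eq_iff_implicitFunction (by simp) hinv
  have ht : Tendsto (fun y => (y, (p y)⁻¹)) (𝓝 x₀) (𝓝 (x₀, 1)) := by
    have : Tendsto (fun y => (p y)⁻¹) (𝓝 x₀) (𝓝 1) := by
      simpa [hp₀] using hp.tendsto.inv₀ (by simp [hp₀])
    exact tendsto_id.prodMk_nhds this
  have heq : (fun y => (p y)⁻¹) =ᶠ[𝓝 x₀] hcd.implicitFunction (by simp) hinv := by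
    filter_upwards [ht.eventually hev, hlevel] with y hy1 hy2
    exact (hy1.1 (by simp [hf, hy2, hx₀])).symm
  have h7 : ContDiffAt ℝ ∞ (fun y => (p y)⁻¹) x₀ := hq.congr_of_eventuallyEq heq
  simpa [Pi.inv_def] using h7.inv (by simp [hp₀])

/-- A seminorm that is smooth near its unit sphere is smooth away from its kernel. -/
theorem Seminorm.contDiffAt_of_sphere (p : Seminorm ℝ X)
    (h : ∀ x, p x = 1 → ContDiffAt ℝ ∞ p x) {x : X} (hx : p x ≠ 0) : ContDiffAt ℝ ∞ p x := by
  have hpos : 0 < p x := lt_of_le_of_ne (apply_nonneg p x) (Ne.symm hx)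
  have h1 : p ((p x)⁻¹ • x) = 1 := by
    rw [map_smul_eq_mul, Real.norm_of_nonneg (inv_nonneg.2 hpos.le), inv_mul_cancel₀ hx]
  have h2 : ContDiffAt ℝ ∞ (fun y => p x * p ((p x)⁻¹ • y)) x :=
    contDiffAt_const.mul (ContDiffAt.comp x (h _ h1) (contDiffAt_id.const_smul _))
  convert h2 using 1
  ext y
  rw [map_smul_eq_mul, Real.norm_of_nonneg (inv_nonneg.2 hpos.le), mul_inv_cancel_left₀ hx]

/-- The radial derivative of a convex function at a point where it exceeds its value at `0`. -/
theorem ConvexOn.fderiv_apply_self_pos {Φ : X → ℝ} (hc : ConvexOn ℝ univ Φ) {x : X}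
    (hd : DifferentiableAt ℝ Φ x) (hx : Φ 0 < Φ x) : 0 < fderiv ℝ Φ x x := by
  have h4 : HasDerivAt (fun t : ℝ => Φ (t • x)) (fderiv ℝ Φ x x) 1 := by
    have h5 : HasFDerivAt Φ (fderiv ℝ Φ x) ((1 : ℝ) • x) := by
      rw [one_smul]
      exact hd.hasFDerivAt
    have h6 : HasDerivAt (fun t : ℝ => t • x) x 1 := by
      simpa using (hasDerivAt_id (1 : ℝ)).smul_const x
    exact h5.comp_hasDerivAt 1 h6
  have hc' : ConvexOn ℝ univ (fun t : ℝ => Φ (t • x)) :=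
    hc.comp_linearMap (LinearMap.toSpanSingleton ℝ X x)
  have := hc'.slope_le_of_hasDerivAt (mem_univ 0) (mem_univ 1) one_pos h4
  rw [slope_def_field] at this
  simp at this
  linarith

/-- If every point of the set `{x | ∀ i, |h i x| < 1 + θ i}` is bounded away from `1` under all but
finitely many of the functionals `h i`, then the set determines a smooth norm. -/
theorem exists_smooth_seminorm [CompleteSpace X] {ι : Type*} (h : ι → StrongDual ℝ X) (θ : ι → ℝ)
    (hθ : ∀ i, 0 < θ i) {L : ℝ} (hL : 0 < L) (hhL : ∀ i, ‖h i‖ ≤ L)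
    (hnorm : ∀ x, (∀ i, |h i x| < 1 + θ i) → ‖x‖ ≤ 1)
    (hfin : ∀ x, (∀ i, |h i x| < 1 + θ i) → ∃ η > 0, {i | 1 - η < |h i x|}.Finite) :
    ∃ p : Seminorm ℝ X, IsSmoothNorm p ∧ ∀ x, ‖x‖ ≤ p x ∧ p x ≤ L * ‖x‖ := by
  choose φ hφs hφc hφ0 hφe hφz hφ1 using fun i => exists_smooth_convex_even (hθ i)
  set Φ : Finset ι → X → ℝ := fun F x => ∑ i ∈ F, φ i (h i x) with hΦ
  have hΦs : ∀ F, ContDiff ℝ ∞ (Φ F) := fun F =>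
    ContDiff.sum fun i _ => (hφs i).comp (h i).contDiff
  have hΦc : ∀ F, ConvexOn ℝ univ (Φ F) := by
    intro F
    refine ⟨convex_univ, fun x _ y _ a b ha hb hab => ?_⟩
    simp only [hΦ, smul_eq_mul, Finset.mul_sum, ← Finset.sum_add_distrib]
    refine Finset.sum_le_sum fun i _ => ?_
    simpa using (hφc i).2 (mem_univ (h i x)) (mem_univ (h i y)) ha hb hab
  have hΦ0 : ∀ F, Φ F 0 = 0 := fun F => Finset.sum_eq_zero fun i _ => hφz i _ (by simp)
  -- Bounding all finite sums amounts to bounding the sum over `ι` by `1`, with no summability to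
  -- check.
  set C : Set X := {x | ∀ F, Φ F x ≤ 1} with hC
  have hCconv : Convex ℝ C := by
    have : C = ⋂ F, {x ∈ univ | Φ F x ≤ 1} := by
      ext; simp [hC]
    rw [this]
    exact convex_iInter fun F => (hΦc F).convex_le 1
  have hCclosed : IsClosed C := by
    have : C = ⋂ F, {x | Φ F x ≤ 1} := by
      ext; simp [hC]
    rw [this]
    exact isClosed_iInter fun F => isClosed_le (hΦs F).continuous continuous_const
  have hball : Metric.ball (0 : X) L⁻¹ ⊆ C := by
    intro x hx F
    rw [mem_ball_zero_iff] at hx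
    have : Φ F x = 0 := by
      refine Finset.sum_eq_zero fun i _ => hφz i _ ?_
      calc |h i x| ≤ ‖h i‖ * ‖x‖ := (h i).le_opNorm x
        _ ≤ L * L⁻¹ := by gcongr; exact hhL i
        _ = 1 := mul_inv_cancel₀ hL.ne'
    rw [this]
    exact zero_le_one
  have hC0 : C ∈ 𝓝 (0 : X) := mem_of_superset (Metric.ball_mem_nhds _ (inv_pos.2 hL)) hball
  have hCabs : Absorbent ℝ C := absorbent_nhds_zero hC0
  have hCsymm : ∀ x ∈ C, -x ∈ C := by
    intro x hx F
    simpa [hΦ, hφe] using hx F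
  have hCbal : Balanced ℝ C := by
    rw [balanced_iff_smul_mem]
    intro a ha x hx
    have h0 : (0 : X) ∈ C := mem_of_mem_nhds hC0
    rcases le_total 0 a with h' | h'
    · exact hCconv.smul_mem_of_zero_mem h0 hx ⟨h', (le_abs_self a).trans ha⟩
    · have := hCconv.smul_mem_of_zero_mem h0 (hCsymm x hx)
        ⟨neg_nonneg.2 h', (neg_le_abs a).trans ha⟩
      simpa using this
  have hCh : ∀ x ∈ C, ∀ i, |h i x| < 1 + θ i := by
    intro x hx i
    by_contra! hcon
    have h1 := hφ1 i _ hcon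
    have h2 := hx {i}
    simp only [hΦ, Finset.sum_singleton] at h2
    linarith
  have hCsub : C ⊆ Metric.closedBall 0 1 := fun x hx => by
    simpa using hnorm x (hCh x hx)
  set p := gaugeSeminorm hCbal hCconv hCabs with hp
  have hpg : ∀ x, p x = gauge C x := fun _ => rfl
  have hlow : ∀ x, ‖x‖ ≤ p x := fun x => by
    have := le_gauge_of_subset_closedBall hCabs zero_le_one hCsub (x := x)
    simpa [hpg] using this
  have hup : ∀ x, p x ≤ L * ‖x‖ := fun x => by
    have := mul_gauge_le_norm hball (x := x)
    rw [inv_mul_le_iff₀ hL] at this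
    exact this
  have hpcont : Continuous p := continuous_gauge hCconv hC0
  refine ⟨p, ?_, fun x => ⟨hlow x, hup x⟩⟩
  intro x hx
  refine (p.contDiffAt_of_sphere ?_ ?_).contDiffWithinAt
  swap
  · exact ((norm_pos_iff.2 hx).trans_le (hlow x)).ne'
  clear hx x
  intro x hx
  have hmem : ∀ z, p z = 1 → z ∈ C := fun z hz => by
    rw [← hCclosed.closure_eq, ← gauge_le_one_iff_mem_closure hCconv hC0]
    exact hz.le
  obtain ⟨η, hη, hF⟩ := hfin x (hCh x (hmem x hx))
  set F := hF.toFinset with hFdef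
  -- Every `h i` is `L`-Lipschitz, so on this ball `|h i|` grows by at most `η` and stays in the
  -- zero set of `φ i` for `i ∉ F`.
  have hnear : ∀ y ∈ Metric.ball x (η / L), ∀ i ∉ F, φ i (h i y) = 0 := by
    intro y hy i hi
    apply hφz
    have h1 : |h i x| ≤ 1 - η := by simpa [hFdef] using hi
    have h2 : |h i y - h i x| ≤ L * (η / L) := by
      rw [← map_sub]
      calc |h i (y - x)| ≤ ‖h i‖ * ‖y - x‖ := (h i).le_opNorm _
        _ ≤ L * (η / L) := by
          gcongr
          · exact hhL i
          · exact (mem_ball_iff_norm.1 hy).le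
    rw [mul_div_cancel₀ _ hL.ne'] at h2
    have h3 := abs_sub_abs_le_abs_sub (h i y) (h i x)
    linarith
  have hle : ∀ y ∈ Metric.ball x (η / L), ∀ G, Φ G y ≤ Φ F y := by
    classical
    intro y hy G
    have h1 : Φ G y = Φ (G ∩ F) y := by
      symm
      refine Finset.sum_subset Finset.inter_subset_left fun i hi hi' => hnear y hy i ?_
      exact fun h' => hi' (Finset.mem_inter.2 ⟨hi, h'⟩)
    rw [h1]
    exact Finset.sum_le_sum_of_subset_of_nonneg Finset.inter_subset_right fun i _ _ => hφ0 i _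
  have hone : ∀ y ∈ Metric.ball x (η / L), p y = 1 → Φ F y = 1 := by
    intro y hy hpy
    refine le_antisymm (hmem y hpy F) ?_
    -- If `Φ F y < 1`, the same holds nearby. There `Φ F` dominates every other finite sum, so `y`
    -- is interior to `C` and its gauge is below `1`.
    by_contra! hlt
    have h1 : y ∈ interior C := by
      rw [mem_interior_iff_mem_nhds]
      filter_upwards [Metric.isOpen_ball.mem_nhds hy,
        (hΦs F).continuous.continuousAt.eventually_lt continuousAt_const hlt] with z hz hz' G
      exact (hle z hz G).trans hz'.le
    have h2 := (gauge_lt_one_iff_mem_interior hCconv hC0).2 h1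
    rw [← hpg, hpy] at h2
    exact lt_irrefl _ h2
  have hxb : x ∈ Metric.ball x (η / L) := Metric.mem_ball_self (by positivity)
  have hx1 : Φ F x = 1 := hone x hxb hx
  refine contDiffAt_of_level_set (hΦs F) hx1 ?_ hpcont.continuousAt hx ?_
  · refine ((hΦc F).fderiv_apply_self_pos ?_ ?_).ne'
    · exact ((hΦs F).differentiable (by simp)).differentiableAt
    · rw [hΦ0, hx1]
      exact zero_lt_one
  · have h1 : Tendsto (fun y => (p y)⁻¹ • y) (𝓝 x) (𝓝 x) := by
      have h2 : Tendsto (fun y => (p y)⁻¹) (𝓝 x) (𝓝 1) := by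
        simpa [hx] using (hpcont.tendsto x).inv₀ (by simp [hx])
      simpa using h2.smul tendsto_id
    have h2 : ∀ᶠ y in 𝓝 x, 0 < p y :=
      continuousAt_const.eventually_lt hpcont.continuousAt (by simp [hx])
    filter_upwards [h1.eventually (Metric.isOpen_ball.mem_nhds hxb), h2] with y hy hpos
    refine hone _ hy ?_
    rw [map_smul_eq_mul, Real.norm_of_nonneg (inv_nonneg.2 hpos.le), inv_mul_cancel₀ hpos.ne']

end SmoothGauge

/-! ### Nets that respect membership patterns -/

section Nets

variable {E : Type*} [PseudoMetricSpace E]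

/-- A maximal subset of `S` that is `δ`-separated within each colour of `c`. -/
theorem exists_coloured_net (S : Set E) (c : E → ℕ) {δ : ℝ} (hδ : 0 < δ) :
    ∃ D ⊆ S, (∀ y ∈ S, ∃ d ∈ D, c y = c d ∧ dist y d ≤ δ) ∧
      ((range c).Finite → ∀ T, IsCompact (closure (S ∩ T)) → (D ∩ T).Finite) := by
  set r : E → E → Prop := fun a b => c a = c b → δ < dist a b with hr
  obtain ⟨D, hD⟩ := zorn_subset {D : Set E | D ⊆ S ∧ D.Pairwise r} (by
    intro A hA hchain
    refine ⟨⋃₀ A, ⟨sUnion_subset fun D hD => (hA hD).1, ?_⟩, fun D => subset_sUnion_of_mem⟩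
    exact (pairwise_sUnion hchain.directedOn).2 fun D hD => (hA hD).2)
  refine ⟨D, hD.prop.1, ?_, ?_⟩
  · intro y hy
    by_contra! hcon
    have hins : insert y D ∈ {D : Set E | D ⊆ S ∧ D.Pairwise r} := by
      refine ⟨insert_subset hy hD.prop.1, hD.prop.2.insert fun b hb _ => ⟨hcon b hb, fun h => ?_⟩⟩
      rw [dist_comm]
      exact hcon b hb h.symm
    have hyD : y ∈ D := hD.le_of_ge hins (subset_insert y D) (mem_insert y D)
    have := hcon y hyD rfl
    rw [dist_self] at this
    exact this.not_ge hδ.le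
  · intro hc T hT
    obtain ⟨t, ht, hcov⟩ := Metric.totallyBounded_iff.1 hT.totallyBounded (δ / 2) (by positivity)
    have hsub : D ∩ T ⊆ ⋃ k ∈ range c, ⋃ y ∈ t, (D ∩ c ⁻¹' {k} ∩ Metric.ball y (δ / 2)) := by
      intro z hz
      have h1 := hcov (subset_closure ⟨hD.prop.1 hz.1, hz.2⟩)
      simp only [mem_iUnion] at h1 ⊢
      obtain ⟨y, hy, hzy⟩ := h1
      exact ⟨c z, mem_range_self z, y, hy, ⟨hz.1, rfl⟩, hzy⟩
    -- Two net points of one colour in one ball of radius `δ / 2` coincide; colours and balls are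
    -- finite in number.
    refine (hc.biUnion fun k _ => ht.biUnion fun y _ => Set.Subsingleton.finite ?_).subset hsub
    rintro a ⟨⟨ha, hak⟩, hay⟩ b ⟨⟨hb, hbk⟩, hby⟩
    by_contra hab
    have h1 : δ < dist a b := hD.prop.2 ha hb hab (hak.trans hbk.symm)
    have h2 := dist_triangle_right a b y
    rw [Metric.mem_ball] at hay hby
    linarith

/-- Nets `D n` of the sets `S n` such that points of `S n` can be approximated by points of `D n`
that belong to the same sets `cl (D m)`, `m < n`. -/
theorem exists_net_sequence (cl : Set E → Set E) (S : ℕ → Set E) {δ : ℕ → ℝ} (hδ : ∀ n, 0 < δ n) :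
    ∃ D : ℕ → Set E, (∀ n, D n ⊆ S n) ∧
      (∀ n, ∀ y ∈ S n, ∃ d ∈ D n, dist y d ≤ δ n ∧ ∀ m < n, (y ∈ cl (D m) ↔ d ∈ cl (D m))) ∧
      ∀ n T, IsCompact (closure (S n ∩ T)) → (D n ∩ T).Finite := by
  classical
  choose net hsub hnet hfin using
    fun (n : ℕ) (c : E → ℕ) => exists_coloured_net (S n) c (hδ n)
  -- The colour `c n z` records in binary which earlier closures contain `z`; recursion is needed
  -- because each net depends on the preceding colouring.
  set c : ℕ → E → ℕ := fun n => Nat.rec (fun _ => 0)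
    (fun n f z => 2 * f z + if z ∈ cl (net n f) then 1 else 0) n with hc
  have hsucc : ∀ n z, c (n + 1) z = 2 * c n z + if z ∈ cl (net n (c n)) then 1 else 0 :=
    fun _ _ => rfl
  have hlt : ∀ n z, c n z < 2 ^ n := by
    intro n
    induction n with
    | zero => intro z; simp [hc]
    | succ n ih =>
      intro z
      have := ih z
      rw [hsucc, pow_succ]
      split_ifs <;> omega
  have hpat : ∀ n y d, c n y = c n d → ∀ m < n, (y ∈ cl (net m (c m)) ↔ d ∈ cl (net m (c m))) := by
    intro n y d
    induction n with
    | zero => intro _ m hm; omega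
    | succ n ih =>
      intro h m hm
      rw [hsucc, hsucc] at h
      have h1 : c n y = c n d := by split_ifs at h <;> omega
      rcases Nat.lt_succ_iff_lt_or_eq.1 hm with h' | rfl
      · exact ih h1 m h'
      · split_ifs at h <;> first | omega | tauto
  refine ⟨fun n => net n (c n), fun n => hsub _ _, fun n y hy => ?_, fun n => hfin _ _ ?_⟩
  · obtain ⟨d, hd, hcd, hdist⟩ := hnet n (c n) y hy
    exact ⟨d, hd, hdist, hpat n y d hcd⟩
  · exact (finite_Iio (2 ^ n)).subset (range_subset_iff.2 fun z => hlt n z)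

end Nets

/-! ### Upper semicontinuous weights counting closed sets -/

section Weight

variable {Z : Type*}

/-- The weighted count of the sets `E n` that contain `z`. -/
noncomputable def memWeight (E : ℕ → Set Z) (z : Z) : ℝ :=
  ∑' n, (E n).indicator (fun _ => (1 / 4 : ℝ) ^ (n + 1)) z

theorem indicator_weight_nonneg (E : ℕ → Set Z) (z : Z) (n : ℕ) :
    0 ≤ (E n).indicator (fun _ => (1 / 4 : ℝ) ^ (n + 1)) z :=
  indicator_nonneg (fun _ _ => by positivity) z

theorem indicator_weight_le (E : ℕ → Set Z) (z : Z) (n : ℕ) :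
    (E n).indicator (fun _ => (1 / 4 : ℝ) ^ (n + 1)) z ≤ (1 / 4 : ℝ) ^ (n + 1) :=
  indicator_le_self' (fun _ _ => by positivity) z

theorem hasSum_quarter_pow (N : ℕ) :
    HasSum (fun n : ℕ => (1 / 4 : ℝ) ^ (n + N + 1)) ((1 / 3) * (1 / 4) ^ N) := by
  have h := (hasSum_geometric_of_lt_one (r := (1 / 4 : ℝ)) (by norm_num) (by norm_num)).mul_left
    ((1 / 4) ^ (N + 1))
  have h1 : (fun n : ℕ => (1 / 4 : ℝ) ^ (n + N + 1)) =
      fun n : ℕ => (1 / 4 : ℝ) ^ (N + 1) * (1 / 4) ^ n := by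
    ext n
    ring
  have h2 : (1 / 3 : ℝ) * (1 / 4) ^ N = (1 / 4) ^ (N + 1) * (1 - 1 / 4)⁻¹ := by
    rw [pow_succ]
    norm_num
    ring
  rw [h1, h2]
  exact h

theorem summable_memWeight (E : ℕ → Set Z) (z : Z) :
    Summable fun n => (E n).indicator (fun _ => (1 / 4 : ℝ) ^ (n + 1)) z :=
  Summable.of_nonneg_of_le (indicator_weight_nonneg E z) (indicator_weight_le E z)
    (by simpa using (hasSum_quarter_pow 0).summable)

theorem memWeight_nonneg (E : ℕ → Set Z) (z : Z) : 0 ≤ memWeight E z :=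
  tsum_nonneg (indicator_weight_nonneg E z)

theorem le_memWeight {E : ℕ → Set Z} {z : Z} {n : ℕ} (h : z ∈ E n) :
    (1 / 4) ^ (n + 1) ≤ memWeight E z := by
  have := (summable_memWeight E z).le_tsum n fun m _ => indicator_weight_nonneg E z m
  rwa [indicator_of_mem h] at this

theorem memWeight_eq_zero {E : ℕ → Set Z} {z : Z} (h : ∀ n, z ∉ E n) : memWeight E z = 0 := by
  simp [memWeight, h]

theorem memWeight_le_sum_add (E : ℕ → Set Z) (z : Z) (N : ℕ) :
    memWeight E z ≤ ∑ n ∈ Finset.range N, (E n).indicator (fun _ => (1 / 4 : ℝ) ^ (n + 1)) z +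
      (1 / 3) * (1 / 4) ^ N := by
  rw [memWeight, ← (summable_memWeight E z).sum_add_tsum_nat_add N]
  gcongr
  rw [← (hasSum_quarter_pow N).tsum_eq]
  exact Summable.tsum_le_tsum (fun n => indicator_weight_le E z (n + N))
    ((summable_nat_add_iff N).2 (summable_memWeight E z)) (hasSum_quarter_pow N).summable

theorem memWeight_le_third (E : ℕ → Set Z) (z : Z) : memWeight E z ≤ 1 / 3 := by
  simpa using memWeight_le_sum_add E z 0

theorem memWeight_le_of_subpattern {E : ℕ → Set Z} {z w : Z} {N : ℕ}
    (h : ∀ m < N, z ∈ E m → w ∈ E m) : memWeight E z ≤ memWeight E w + (1 / 3) * (1 / 4) ^ N := by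
  refine (memWeight_le_sum_add E z N).trans ?_
  gcongr
  refine (Finset.sum_le_sum fun m hm => ?_).trans
    ((summable_memWeight E w).sum_le_tsum _ fun m _ => indicator_weight_nonneg E w m)
  by_cases hz : z ∈ E m
  · rw [indicator_of_mem hz, indicator_of_mem (h m (Finset.mem_range.1 hm) hz)]
  · rw [indicator_of_notMem hz]
    exact indicator_weight_nonneg E w m

/-- With ratio `1 / 4` the tail beyond index `n` is only a third of the `n`-th weight, so gaining `E
n` outweighs any loss of later sets. -/
theorem memWeight_add_le_of_subpattern {E : ℕ → Set Z} {z w : Z} {N n : ℕ}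
    (h : ∀ m < N, z ∈ E m → w ∈ E m) (hn : n < N) (hz : z ∉ E n) (hw : w ∈ E n) :
    memWeight E z + (1 / 4) ^ (n + 1) ≤ memWeight E w + (1 / 3) * (1 / 4) ^ N := by
  have h1 := memWeight_le_sum_add E z N
  have h2 := (summable_memWeight E w).sum_le_tsum (Finset.range N)
    fun m _ => indicator_weight_nonneg E w m
  have h3 : ∑ m ∈ Finset.range N, ((E m).indicator (fun _ => (1 / 4 : ℝ) ^ (m + 1)) z +
      if m = n then (1 / 4 : ℝ) ^ (n + 1) else 0) ≤
      ∑ m ∈ Finset.range N, (E m).indicator (fun _ => (1 / 4 : ℝ) ^ (m + 1)) w := by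
    refine Finset.sum_le_sum fun m hm => ?_
    split_ifs with hmn
    · subst hmn
      rw [indicator_of_notMem hz, indicator_of_mem hw, zero_add]
    · rw [add_zero]
      by_cases hzm : z ∈ E m
      · rw [indicator_of_mem hzm, indicator_of_mem (h m (Finset.mem_range.1 hm) hzm)]
      · rw [indicator_of_notMem hzm]
        exact indicator_weight_nonneg E w m
  rw [Finset.sum_add_distrib, Finset.sum_ite_eq' (Finset.range N) n,
    if_pos (Finset.mem_range.2 hn)] at h3
  unfold memWeight at h1 ⊢
  linarith

variable [TopologicalSpace Z]

/-- Avoiding a closed set is an open condition, so nearby points can lose memberships but cannot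
gain any of the first `N`. -/
theorem eventually_subpattern {E : ℕ → Set Z} (hE : ∀ n, IsClosed (E n)) (y : Z) (N : ℕ) :
    ∀ᶠ z in 𝓝 y, ∀ m < N, z ∈ E m → y ∈ E m := by
  have h : ∀ m ∈ Finset.range N, ∀ᶠ z in 𝓝 y, z ∈ E m → y ∈ E m := by
    intro m _
    by_cases hy : y ∈ E m
    · exact Eventually.of_forall fun _ _ => hy
    · filter_upwards [(hE m).isOpen_compl.mem_nhds hy] with z hz hz'
      exact absurd hz' hz
  filter_upwards [(Finset.eventually_all (Finset.range N)).2 h] with z hz m hm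
  exact hz m (Finset.mem_range.2 hm)

theorem eventually_memWeight_le {E : ℕ → Set Z} (hE : ∀ n, IsClosed (E n)) (y : Z) {κ : ℝ}
    (hκ : 0 < κ) : ∀ᶠ z in 𝓝 y, memWeight E z ≤ memWeight E y + κ := by
  obtain ⟨N, hN⟩ := exists_pow_lt_of_lt_one hκ (show (1 / 4 : ℝ) < 1 by norm_num)
  filter_upwards [eventually_subpattern hE y N] with z hz
  have := memWeight_le_of_subpattern hz
  have h4 : (0 : ℝ) < (1 / 4) ^ N := by positivity
  linarith

theorem eventually_memWeight_add_le {E : ℕ → Set Z} (hE : ∀ n, IsClosed (E n)) {y : Z} {n : ℕ}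
    (hy : y ∈ E n) {κ : ℝ} (hκ : 0 < κ) :
    ∀ᶠ z in 𝓝 y, z ∉ E n → memWeight E z + (1 / 4) ^ (n + 1) ≤ memWeight E y + κ := by
  obtain ⟨N, hN⟩ := exists_pow_lt_of_lt_one hκ (show (1 / 4 : ℝ) < 1 by norm_num)
  filter_upwards [eventually_subpattern hE y (N + n + 1)] with z hz hzn
  have := memWeight_add_le_of_subpattern hz (by omega) hzn hy
  have h4 : (1 / 4 : ℝ) ^ (N + n + 1) ≤ (1 / 4) ^ N :=
    pow_le_pow_of_le_one (by norm_num) (by norm_num) (by omega)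
  have h5 : (0 : ℝ) < (1 / 4) ^ (N + n + 1) := by positivity
  linarith

end Weight

/-! ### The norm built from a boundary -/

section Boundary

variable {X : Type*} [NormedAddCommGroup X] [NormedSpace ℝ X]

theorem IsWeakStarLRC.mono {S T : Set (StrongDual ℝ X)} (hT : IsWeakStarLRC T) (h : S ⊆ T) :
    IsWeakStarLRC S := by
  intro y hy
  obtain ⟨U, hU, hyU, hc⟩ := hT y (h hy)
  exact ⟨U, hU, hyU, hc.of_isClosed_subset isClosed_closure
    (closure_mono (inter_subset_inter_left _ h))⟩

/-- A `σ`-`w*`-LRC and `σ`-`w*`-compact set is a disjoint union of countably many `w*`-LRC sets that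
lie in `w*`-closed subsets of it. -/
theorem exists_disjoint_decomposition {B : Set (StrongDual ℝ X)} (hB : IsSigmaWeakStarLRC B)
    (hB' : IsSigmaWeakStarCompact B) :
    ∃ S : ℕ → Set (StrongDual ℝ X), (∀ n, IsWeakStarLRC (S n)) ∧ Pairwise (Function.onFun Disjoint S) ∧
      (⋃ n, S n) = B ∧ ∀ n, closure (StrongDual.toWeakDual '' S n) ⊆ StrongDual.toWeakDual '' B := by
  obtain ⟨R, hR, hBR⟩ := hB
  obtain ⟨K, hK, hBK⟩ := hB'
  set S : ℕ → Set (StrongDual ℝ X) :=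
    fun n => R n.unpair.1 ∩ StrongDual.toWeakDual ⁻¹' K n.unpair.2 with hS
  refine ⟨disjointed S, fun n => ?_, disjoint_disjointed S, ?_, fun n => ?_⟩
  · exact (hR _).mono ((disjointed_subset S n).trans inter_subset_left)
  · rw [iUnion_disjointed]
    ext y
    simp only [hS, mem_iUnion]
    constructor
    · rintro ⟨n, hn, -⟩
      rw [hBR]
      exact mem_iUnion_of_mem _ hn
    · intro hy
      have h1 : StrongDual.toWeakDual y ∈ ⋃ n, K n := hBK ▸ mem_image_of_mem _ hy
      rw [hBR] at hy
      obtain ⟨i, hi⟩ := mem_iUnion.1 hy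
      obtain ⟨j, hj⟩ := mem_iUnion.1 h1
      exact ⟨Nat.pair i j, by simpa using hi, by simpa using hj⟩
  · have h1 : StrongDual.toWeakDual '' disjointed S n ⊆ K n.unpair.2 :=
      image_subset_iff.2 ((disjointed_subset S n).trans inter_subset_right)
    rw [← hBK]
    exact (closure_minimal h1 (hK _).isClosed).trans (subset_iUnion K _)

/-- If `D` meets the relatively norm compact parts of a `w*`-LRC set `S` in finite sets, then a
point of `S` is not a `w*`-accumulation point of `D`. -/
theorem IsWeakStarLRC.eventually_eq_of_mem_closure {S D : Set (StrongDual ℝ X)}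
    (hS : IsWeakStarLRC S) (hfin : ∀ T, IsCompact (closure (S ∩ T)) → (D ∩ T).Finite)
    {y : StrongDual ℝ X} (hy : y ∈ S) :
    (∀ᶠ z in 𝓝 (StrongDual.toWeakDual y), z ∈ closure (StrongDual.toWeakDual '' D) →
      z = StrongDual.toWeakDual y) ∧
    (StrongDual.toWeakDual y ∈ closure (StrongDual.toWeakDual '' D) → y ∈ D) := by
  obtain ⟨U, hU, hyU, hc⟩ := hS y hy
  have hf := ((hfin _ hc).subset (sdiff_subset (t := {y}))).image StrongDual.toWeakDual
  -- Only finitely many points of `D` lie in `U`; deleting those other than `y` leaves a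
  -- neighbourhood of `y` that meets `D` at most in `y`.
  set V : Set (WeakDual ℝ X) := U \ (StrongDual.toWeakDual ''
    ((D ∩ StrongDual.toWeakDual ⁻¹' U) \ {y})) with hV
  have hVo : IsOpen V := hU.sdiff hf.isClosed
  have hyV : StrongDual.toWeakDual y ∈ V := by
    refine ⟨hyU, ?_⟩
    rintro ⟨d, ⟨-, hdy⟩, hd⟩
    exact hdy (StrongDual.toWeakDual.injective hd)
  have hVD : ∀ d ∈ D, StrongDual.toWeakDual d ∈ V → d = y := by
    intro d hd hdV
    by_contra hne
    exact hdV.2 ⟨d, ⟨⟨hd, hdV.1⟩, hne⟩, rfl⟩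
  constructor
  · filter_upwards [hVo.mem_nhds hyV] with z hz hzD
    have h1 : z ∈ closure (V ∩ StrongDual.toWeakDual '' D) :=
      hVo.inter_closure ⟨hz, hzD⟩
    have h2 : V ∩ StrongDual.toWeakDual '' D ⊆ {StrongDual.toWeakDual y} := by
      rintro _ ⟨hw, d, hd, rfl⟩
      rw [hVD d hd hw]
      rfl
    simpa using closure_mono h2 h1
  · intro hcl
    obtain ⟨_, hw, d, hd, rfl⟩ := mem_closure_iff.1 hcl V hVo hyV
    rwa [← hVD d hd hw]

/-- The main construction: scale the elements of suitable discrete nets in the boundary. -/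
theorem exists_smooth_seminorm_of_boundary [CompleteSpace X] {B : Set (StrongDual ℝ X)}
    (hB : IsBoundary B) (hLRC : IsSigmaWeakStarLRC B) (hcpt : IsSigmaWeakStarCompact B)
    {e : ℝ} (he : 0 < e) (he1 : e ≤ 1) :
    ∃ p : Seminorm ℝ X, IsSmoothNorm p ∧ ∀ x, ‖x‖ ≤ p x ∧ p x ≤ (1 + e) * ‖x‖ := by
  obtain ⟨S, hSL, hSd, hSB, hScl⟩ := exists_disjoint_decomposition hLRC hcpt
  set b : ℕ → ℝ := fun n => e * (1 / 4) ^ (n + 1) with hb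
  have hb0 : ∀ n, 0 < b n := fun n => by positivity
  have hb1 : ∀ n, b n ≤ 1 := fun n =>
    mul_le_one₀ he1 (by positivity) (pow_le_one₀ (by norm_num) (by norm_num))
  obtain ⟨D, hDS, hDnet, hDfin⟩ := exists_net_sequence
    (fun A : Set (StrongDual ℝ X) =>
      StrongDual.toWeakDual ⁻¹' closure (StrongDual.toWeakDual '' A)) S
    (δ := fun n => b n / 16) (fun n => by have := hb0 n; positivity)
  set E : ℕ → Set (WeakDual ℝ X) := fun n => closure (StrongDual.toWeakDual '' D n) with hE
  have hEc : ∀ n, IsClosed (E n) := fun n => isClosed_closure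
  have hEB : ∀ n, E n ⊆ StrongDual.toWeakDual '' B := fun n =>
    (closure_mono (image_mono (hDS n))).trans (hScl n)
  have hDE : ∀ n, ∀ d ∈ D n, StrongDual.toWeakDual d ∈ E n := fun n d hd =>
    subset_closure (mem_image_of_mem _ hd)
  set F : StrongDual ℝ X → ℝ := fun d => e * memWeight E (StrongDual.toWeakDual d) with hF
  have hF0 : ∀ d, 0 ≤ F d := fun d => mul_nonneg he.le (memWeight_nonneg _ _)
  have hF1 : ∀ d, F d ≤ e / 3 := fun d => by
    have := mul_le_mul_of_nonneg_left (memWeight_le_third E (StrongDual.toWeakDual d)) he.le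
    simp only [hF]
    linarith
  have hFb : ∀ n, ∀ d ∈ D n, b n ≤ F d := fun n d hd =>
    mul_le_mul_of_nonneg_left (le_memWeight (hDE n d hd)) he.le
  let ι := {d : StrongDual ℝ X // ∃ n, d ∈ D n}
  choose ν hν using fun i : ι => i.2
  -- Disjointness of the `S n` gives each net point a unique index, so the tolerance `θ` matches the
  -- net it comes from.
  have hνD : ∀ n (d : StrongDual ℝ X) (hd : d ∈ D n), ν ⟨d, n, hd⟩ = n := by
    intro n d hd
    by_contra hne
    exact disjoint_left.1 (hSd hne) (hDS _ (hν ⟨d, n, hd⟩)) (hDS n hd)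
  set h : ι → StrongDual ℝ X := fun i => (1 + F i.1) • i.1 with hh
  set θ : ι → ℝ := fun i => b (ν i) / 16 with hθ
  have hιB : ∀ i : ι, i.1 ∈ B := fun i => hSB ▸ mem_iUnion_of_mem _ (hDS _ (hν i))
  have hι1 : ∀ i : ι, ‖i.1‖ ≤ 1 := fun i => by simpa using hB.1 (hιB i)
  have habs : ∀ i x, |h i x| = (1 + F i.1) * |i.1 x| := by
    intro i x
    have h1 : h i x = (1 + F i.1) * i.1 x := rfl
    rw [h1, abs_mul, abs_of_nonneg (by have := hF0 i.1; linarith)]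
  have hD : ∀ x, (∀ i, |h i x| < 1 + θ i) → ∀ n, ∀ d ∈ D n, (1 + F d) * |d x| < 1 + b n / 16 := by
    intro x hx n d hd
    have h1 := hx ⟨d, n, hd⟩
    rw [habs] at h1
    simpa [hθ, hνD n d hd] using h1
  have hnorm : ∀ x, (∀ i, |h i x| < 1 + θ i) → ‖x‖ < 1 := by
    intro x hx
    rcases eq_or_ne x 0 with rfl | hx0
    · simp
    have hxpos : 0 < ‖x‖ := norm_pos_iff.2 hx0
    obtain ⟨f, hfB, hfx⟩ := hB.2 (‖x‖⁻¹ • x) (by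
      rw [norm_smul, norm_inv, norm_norm, inv_mul_cancel₀ hxpos.ne'])
    have hfx' : f x = ‖x‖ := by
      rw [map_smul, smul_eq_mul, inv_mul_eq_iff_eq_mul₀ hxpos.ne', mul_one] at hfx
      exact hfx
    rw [← hSB] at hfB
    obtain ⟨n, hn⟩ := mem_iUnion.1 hfB
    obtain ⟨d, hd, hfd, -⟩ := hDnet n f hn
    have h1 := hD x hx n d hd
    have h2 : |f x - d x| ≤ b n / 16 * ‖x‖ := by
      have := (f - d).le_of_opNorm_le (dist_eq_norm f d ▸ hfd) x
      simpa using this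
    have h3 : (1 - b n / 16) * ‖x‖ ≤ |d x| := by
      have := (abs_le.1 h2).2
      have := le_abs_self (d x)
      rw [hfx'] at *
      linarith
    have h4 : (1 + b n) * ((1 - b n / 16) * ‖x‖) ≤ (1 + F d) * |d x| := by
      have h5 := hb0 n
      have h6 := hb1 n
      have h7 := hFb n d hd
      exact mul_le_mul (by linarith) h3 (mul_nonneg (by linarith) hxpos.le) (by linarith)
    have h5 : (1 + b n / 16) * ‖x‖ ≤ (1 + b n) * ((1 - b n / 16) * ‖x‖) := by
      have h6 : 1 + b n / 16 ≤ (1 + b n) * (1 - b n / 16) := by nlinarith [hb0 n, hb1 n]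
      rw [← mul_assoc]
      gcongr
    have h7 : (1 + b n / 16) * ‖x‖ < (1 + b n / 16) * 1 := by linarith
    exact lt_of_mul_lt_mul_left h7 (by have := hb0 n; positivity)
  -- points of the boundary are dominated by nearby elements of the nets
  have hdom : ∀ y ∈ B, ∃ n, ∃ d ∈ D n, dist y d ≤ b n / 16 ∧
      ∀ᶠ z in 𝓝 (StrongDual.toWeakDual y), z ≠ StrongDual.toWeakDual y →
        e * memWeight E z ≤ F d - b n / 2 := by
    intro y hy
    rw [← hSB] at hy
    obtain ⟨n, hn⟩ := mem_iUnion.1 hy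
    have hq : (0 : ℝ) < (1 / 4) ^ (n + 1) := by positivity
    obtain ⟨hiso, hmem⟩ := (hSL n).eventually_eq_of_mem_closure (hDfin n) hn
    -- If `y ∈ E n`, then `y ∈ D n` is isolated in `E n`; nearby points other than `y` leave `E n`
    -- and lose its weight, and `d = y` works.
    by_cases hyE : StrongDual.toWeakDual y ∈ E n
    · refine ⟨n, y, hmem hyE, by rw [dist_self]; have := hb0 n; positivity, ?_⟩
      filter_upwards [hiso, eventually_memWeight_add_le hEc hyE (half_pos hq)] with z hz hz' hzy
      have h1 := hz' fun h => hzy (hz h)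
      have h2 := mul_le_mul_of_nonneg_left h1 he.le
      simp only [hF, hb]
      linarith
    -- Here `d` shares the memberships of `y` below `n` and gains `E n`. Of the gain `4^{-(n+1)}`
    -- the tail costs a third and semicontinuity a sixth, leaving the half.
    · obtain ⟨d, hd, hyd, hpat⟩ := hDnet n y hn
      refine ⟨n, d, hd, hyd, ?_⟩
      have h1 := memWeight_add_le_of_subpattern (E := E) (z := StrongDual.toWeakDual y)
        (w := StrongDual.toWeakDual d) (N := n + 1) (n := n) (by
          intro m hm hym
          rcases Nat.lt_succ_iff_lt_or_eq.1 hm with h' | rfl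
          · exact (hpat m h').1 hym
          · exact absurd hym hyE) (by omega) hyE (hDE n d hd)
      filter_upwards [eventually_memWeight_le hEc (StrongDual.toWeakDual y)
        (show (0 : ℝ) < (1 / 4) ^ (n + 1) / 6 by positivity)] with z hz _
      have h2 : memWeight E z ≤ memWeight E (StrongDual.toWeakDual d) - (1 / 4) ^ (n + 1) / 2 := by
        linarith
      have h3 := mul_le_mul_of_nonneg_left h2 he.le
      simp only [hF, hb]
      linarith
  have hfin : ∀ x, (∀ i, |h i x| < 1 + θ i) → ∃ η > 0, {i | 1 - η < |h i x|}.Finite := by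
    intro x hx
    by_contra! hcon
    have hx1 := hnorm x hx
    -- The values `|h i x|` may exceed `1`; truncation forces the cluster value to be exactly `1`.
    set g : ι → ℝ := fun i => min |h i x| 1 with hg
    have hclus : MapClusterPt 1 cofinite g := by
      rw [mapClusterPt_iff_frequently]
      intro s hs
      obtain ⟨η, hη, hηs⟩ := Metric.mem_nhds_iff.1 hs
      rw [frequently_cofinite_iff_infinite]
      refine Set.Infinite.mono ?_ (hcon η hη)
      intro i hi
      apply hηs
      rw [Metric.mem_ball, Real.dist_eq, abs_lt]
      have h1 : 1 - η < g i := lt_min hi (by linarith)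
      have h2 : g i ≤ 1 := min_le_right _ _
      constructor <;> linarith
    obtain ⟨u, hu, hug⟩ := mapClusterPt_iff_ultrafilter.1 hclus
    obtain ⟨y', hy', huy⟩ := (WeakDual.isCompact_closedBall (𝕜 := ℝ) (0 : StrongDual ℝ X)
      1).ultrafilter_le_nhds (u.map fun i : ι => StrongDual.toWeakDual i.1) (by
        rw [le_principal_iff]
        refine Ultrafilter.mem_map.2 (univ_mem' fun i => ?_)
        simpa using hι1 i)
    obtain ⟨y, rfl⟩ := StrongDual.toWeakDual.surjective y'
    have hy1 : ‖y‖ ≤ 1 := by simpa using hy'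
    have huy' : Tendsto (fun i : ι => StrongDual.toWeakDual i.1) u
      (𝓝 (StrongDual.toWeakDual y)) := huy
    have heval : Tendsto (fun i : ι => i.1 x) u (𝓝 (y x)) :=
      ((WeakDual.eval_continuous x).tendsto (StrongDual.toWeakDual y)).comp huy'
    have hne : ∀ᶠ i in (u : Filter ι), StrongDual.toWeakDual i.1 ≠ StrongDual.toWeakDual y := by
      apply hu
      rw [mem_cofinite]
      refine Set.Subsingleton.finite fun i hi j hj => Subtype.ext ?_
      have hi' : StrongDual.toWeakDual i.1 = StrongDual.toWeakDual y := by simpa using hi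
      have hj' : StrongDual.toWeakDual j.1 = StrongDual.toWeakDual y := by simpa using hj
      exact StrongDual.toWeakDual.injective (hi'.trans hj'.symm)
    have hbound : ∀ μ : ℝ, (∀ᶠ i in (u : Filter ι), 1 + F i.1 ≤ μ) → 1 ≤ μ * |y x| := by
      intro μ hμ
      refine le_of_tendsto_of_tendsto hug (heval.abs.const_mul μ) ?_
      filter_upwards [hμ] with i hi
      calc g i ≤ |h i x| := min_le_left _ _
        _ = (1 + F i.1) * |i.1 x| := habs i x
        _ ≤ μ * |i.1 x| := by gcongr
    by_cases hyB : y ∈ B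
    · obtain ⟨n, d, hd, hyd, hev⟩ := hdom y hyB
      have h1 := hbound (1 + F d - b n / 2) (by
        filter_upwards [huy'.eventually hev, hne] with i hi hi'
        have : F i.1 ≤ F d - b n / 2 := hi hi'
        linarith)
      have h2 := hD x hx n d hd
      have h3 : |y x - d x| ≤ b n / 16 * 1 := by
        have := (y - d).le_of_opNorm_le_of_le (dist_eq_norm y d ▸ hyd) hx1.le
        simpa using this
      have h4 := abs_sub_abs_le_abs_sub (y x) (d x)
      have h5 : |y x| ≤ 1 := ((y.le_of_opNorm_le hy1 x).trans (by rw [one_mul])).trans hx1.le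
      have h6 : |y x| - b n / 16 ≤ |d x| := by linarith
      have h7 := mul_le_mul_of_nonneg_left h6 (by have := hF0 d; linarith : 0 ≤ 1 + F d)
      have h8 : 3 / 4 ≤ |y x| := by
        nlinarith [hF1 d, hb0 n, abs_nonneg (y x)]
      -- `h1` and `h8` give `(1 + F d) * |y x| ≥ 1 + 3 * b n / 8`, whereas `h2` and `h7` with `F d ≤
      -- 1 / 3` bound it by `1 + 7 * b n / 48`.
      nlinarith [hF1 d, hb0 n, hF0 d]
    · have hyE : memWeight E (StrongDual.toWeakDual y) = 0 := by
        refine memWeight_eq_zero fun n hn => ?_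
        obtain ⟨z, hz, hzy⟩ := hEB n hn
        exact hyB (StrongDual.toWeakDual.injective hzy ▸ hz)
      have hyx : |y x| ≤ ‖x‖ := (y.le_of_opNorm_le hy1 x).trans (by rw [one_mul])
      have h1 := hbound (1 + (1 - ‖x‖)) (by
        have hpos : 0 < 1 - ‖x‖ := by linarith
        filter_upwards [huy'.eventually (eventually_memWeight_le hEc _ hpos)] with i hi
        rw [hyE, zero_add] at hi
        have h2 : F i.1 ≤ 1 * memWeight E (StrongDual.toWeakDual i.1) :=
          mul_le_mul_of_nonneg_right he1 (memWeight_nonneg _ _)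
        linarith)
      -- The contradiction is `(2 - ‖x‖) * ‖x‖ = 1 - (1 - ‖x‖) ^ 2 < 1`.
      nlinarith [abs_nonneg (y x)]
  refine exists_smooth_seminorm h θ (fun i => by have := hb0 (ν i); positivity)
    (by positivity) (fun i => ?_) (fun x hx => (hnorm x hx).le) hfin
  have h1 : ‖h i‖ = (1 + F i.1) * ‖i.1‖ := by
    rw [hh, norm_smul, Real.norm_of_nonneg (by have := hF0 i.1; linarith)]
  rw [h1]
  have := hF1 i.1
  nlinarith [hF0 i.1, hι1 i, norm_nonneg i.1]

theorem IsBoundary.hasApproximatingSmoothNorms [CompleteSpace X] {B : Set (StrongDual ℝ X)}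
    (hB : IsBoundary B) (hLRC : IsSigmaWeakStarLRC B) (hcpt : IsSigmaWeakStarCompact B) :
    HasApproximatingSmoothNorms X := by
  intro ε hε
  obtain ⟨p, hps, hp⟩ := exists_smooth_seminorm_of_boundary hB hLRC hcpt
    (lt_min hε one_pos) (min_le_right ε 1)
  refine ⟨p, ⟨1, 1 + min ε 1, one_pos, by positivity, fun x => ?_⟩, hps, fun x => ⟨?_, ?_⟩⟩
  · rw [one_mul]
    exact hp x
  · nlinarith [(hp x).1, norm_nonneg x]
  · refine (hp x).2.trans ?_
    gcongr
    exact min_le_left _ _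

theorem IsSigmaCompact.isSigmaWeakStarLRC {C : Set (StrongDual ℝ X)} (hC : IsSigmaCompact C) :
    IsSigmaWeakStarLRC C := by
  obtain ⟨K, hK, rfl⟩ := hC
  refine ⟨K, fun n y _ => ⟨univ, isOpen_univ, mem_univ _, ?_⟩, rfl⟩
  simpa using (hK n).closure

theorem IsSigmaCompact.isSigmaWeakStarCompact {C : Set (StrongDual ℝ X)} (hC : IsSigmaCompact C) :
    IsSigmaWeakStarCompact C :=
  hC.image NormedSpace.Dual.toWeakDual_continuous

end Boundary

/-! ### Signed point evaluations on `C(K)` -/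

section ContinuousFunctions

variable {K : Type*} [TopologicalSpace K]

/-- The functionals `±δ_t`. -/
noncomputable def signedEval (s : Bool) (t : K) : StrongDual ℝ C(K, ℝ) :=
  (if s then 1 else -1 : ℝ) • ContinuousMap.evalCLM ℝ t

theorem signedEval_apply (s : Bool) (t : K) (x : C(K, ℝ)) :
    signedEval s t x = (if s then 1 else -1 : ℝ) * x t := rfl

theorem continuous_signedEval (s : Bool) :
    Continuous fun t : K => StrongDual.toWeakDual (signedEval s t) :=
  WeakDual.continuous_of_continuous_eval fun x => by
    change Continuous fun t => (if s then 1 else -1 : ℝ) * x t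
    fun_prop

variable [CompactSpace K]

theorem isBoundary_signedEval :
    IsBoundary (⋃ s, range (signedEval s) : Set (StrongDual ℝ C(K, ℝ))) := by
  constructor
  · refine iUnion_subset fun s => range_subset_iff.2 fun t => ?_
    refine mem_closedBall_zero_iff.2 ?_
    refine ContinuousLinearMap.opNorm_le_bound _ zero_le_one fun x => ?_
    have h1 : ‖(if s then 1 else -1 : ℝ)‖ = 1 := by cases s <;> simp
    rw [signedEval_apply, norm_mul, h1]
    gcongr
    exact x.norm_coe_le_norm t
  · intro x hx
    have hne : Nonempty K := by
      by_contra hK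
      rw [not_nonempty_iff] at hK
      have : x = 0 := by ext t; exact (hK.false t).elim
      simp [this] at hx
    obtain ⟨t, -, ht⟩ := isCompact_univ.exists_isMaxOn univ_nonempty
      x.continuous.norm.continuousOn
    have ht1 : |x t| = 1 := by
      refine le_antisymm (hx ▸ x.norm_coe_le_norm t) ?_
      rw [← hx, x.norm_le (abs_nonneg _)]
      exact fun r => ht (mem_univ r)
    rcases (abs_eq zero_le_one).1 ht1 with h | h
    · exact ⟨signedEval true t, mem_iUnion_of_mem true (mem_range_self t),
        by simp [signedEval_apply, h]⟩
    · exact ⟨signedEval false t, mem_iUnion_of_mem false (mem_range_self t),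
        by simp [signedEval_apply, h]⟩

theorem isSigmaWeakStarCompact_signedEval :
    IsSigmaWeakStarCompact (⋃ s, range (signedEval s) : Set (StrongDual ℝ C(K, ℝ))) := by
  refine IsCompact.isSigmaCompact ?_
  rw [image_iUnion]
  refine isCompact_iUnion fun s => ?_
  rw [← range_comp]
  exact isCompact_range (continuous_signedEval s)

/-- An Urysohn function supported in the isolating set `U` defines a `w*`-open half-space that
contains only one of these evaluations. -/
theorem isWeakStarLRC_signedEval [T2Space K] (s : Bool) {D : Set K}
    (hD : ∀ x ∈ D, ∃ U : Set K, IsOpen U ∧ U ∩ D = {x}) :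
    IsWeakStarLRC (signedEval s '' D : Set (StrongDual ℝ C(K, ℝ))) := by
  rintro _ ⟨t, ht, rfl⟩
  obtain ⟨U, hU, hUD⟩ := hD t ht
  have htU : t ∈ U := (hUD.symm ▸ mem_singleton t : t ∈ U ∩ D).1
  obtain ⟨f, hf0, hf1, -⟩ := exists_continuous_zero_one_of_isClosed hU.isClosed_compl
    (isClosed_singleton (x := t)) (by simpa using htU)
  have hsq : ∀ r : ℝ, (if s then 1 else -1 : ℝ) * ((if s then 1 else -1 : ℝ) * r) = r := by
    intro r
    cases s <;> simp
  refine ⟨{z | 0 < (if s then 1 else -1 : ℝ) * z f}, ?_, ?_, ?_⟩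
  · exact isOpen_lt continuous_const ((WeakDual.eval_continuous f).const_mul _)
  · change 0 < (if s then 1 else -1 : ℝ) * ((if s then 1 else -1 : ℝ) * f t)
    rw [hsq, hf1 (mem_singleton t)]
    exact one_pos
  · refine ((Set.finite_singleton (signedEval s t)).subset ?_).isCompact_closure
    rintro _ ⟨⟨r, hr, rfl⟩, hrU⟩
    change 0 < (if s then 1 else -1 : ℝ) * ((if s then 1 else -1 : ℝ) * f r) at hrU
    rw [hsq] at hrU
    have hrU' : r ∈ U := by
      by_contra h
      rw [hf0 h] at hrU
      exact lt_irrefl _ hrU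
    have : r ∈ U ∩ D := ⟨hrU', hr⟩
    rw [hUD] at this
    rw [mem_singleton_iff.1 this]
    rfl

theorem isSigmaWeakStarLRC_signedEval [T2Space K] (hK : IsSigmaDiscreteSpace K) :
    IsSigmaWeakStarLRC (⋃ s, range (signedEval s) : Set (StrongDual ℝ C(K, ℝ))) := by
  obtain ⟨D, hDu, hD⟩ := hK
  -- The last binary digit of `n` codes the sign and the remaining digits the index of the discrete
  -- piece.
  refine ⟨fun n => signedEval n.bodd '' D n.div2, fun n => isWeakStarLRC_signedEval _ (hD _), ?_⟩
  ext f
  simp only [mem_iUnion]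
  constructor
  · rintro ⟨s, t, rfl⟩
    obtain ⟨n, hn⟩ := mem_iUnion.1 (hDu.symm ▸ mem_univ t : t ∈ ⋃ n, D n)
    refine ⟨Nat.bit s n, ?_⟩
    rw [Nat.bodd_bit, Nat.div2_bit]
    exact mem_image_of_mem _ hn
  · rintro ⟨n, t, -, rfl⟩
    exact ⟨_, mem_range_self t⟩

end ContinuousFunctions

/-! ### The corollary and its two cases -/

theorem mainTheorem2 :
    -- the corollary
    (∀ (X : Type*) [NormedAddCommGroup X] [NormedSpace ℝ X] [CompleteSpace X]
      (B : Set (StrongDual ℝ X)), IsBoundary B → IsSigmaWeakStarLRC B →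
      IsSigmaWeakStarCompact B → HasApproximatingSmoothNorms X) ∧
    -- the case of a boundary contained in a norm σ-compact subset of the dual unit ball
    (∀ (X : Type*) [NormedAddCommGroup X] [NormedSpace ℝ X] [CompleteSpace X]
      (B C : Set (StrongDual ℝ X)), IsBoundary B → B ⊆ C → C ⊆ Metric.closedBall 0 1 →
      IsSigmaCompact C → HasApproximatingSmoothNorms X) ∧
    -- the case of `C(K)` for a σ-discrete compact Hausdorff space `K`
    (∀ (K : Type*) [TopologicalSpace K] [CompactSpace K] [T2Space K],
      IsSigmaDiscreteSpace K → HasApproximatingSmoothNorms C(K, ℝ)) := by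
  refine ⟨fun X _ _ _ B hB hL hc => hB.hasApproximatingSmoothNorms hL hc, ?_, ?_⟩
  · intro X _ _ _ B C hB hBC hC hσ
    -- The larger set `C` is itself a boundary, so `B` need not inherit any compactness.
    have hCb : IsBoundary C := ⟨hC, fun x hx => (hB.2 x hx).imp fun f hf => ⟨hBC hf.1, hf.2⟩⟩
    exact hCb.hasApproximatingSmoothNorms hσ.isSigmaWeakStarLRC hσ.isSigmaWeakStarCompact
  · intro K _ _ _ hK
    exact isBoundary_signedEval.hasApproximatingSmoothNorms (isSigmaWeakStarLRC_signedEval hK)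
      isSigmaWeakStarCompact_signedEval
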